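/- Let $K$ be a field of characteristic $0$, let $q\in K\setminus\{0\}$ and let $n$ be a positive integer. Let $M_q(n)$ be the standard (Faddeev–Reshetikhin–Takhtajan) quantized matrix algebra: the associative unital $K$-algebra generated by $z_{ij}$, $1\le i,j\le n$, subject to $$\begin{array}{ll} z_{ij}z_{ik}=q\,z_{ik}z_{ij} & (j<k),\\ z_{ij}z_{kj}=q\,z_{kj}z_{ij} & (i<k),\\ z_{ij}z_{st}=z_{st}z_{ij} & (i<s,\ t<j),\\ z_{ij}z_{st}=z_{st}z_{ij}+(q-q^{-1})z_{it}z_{sj} & (i<s,\ j<t).\end{array}$$ List the generators as $a_1,\dots,a_N$, $N=n^2$, in decreasing lexicographic order of their indices, i.e. $z_{nn},z_{n,n-1},\dots,z_{n1},z_{n-1,n},\dots,z_{11}$. Write $a^\alpha=a_1^{\alpha_1}\cdots a_N^{\alpha_N}$ for $\alpha\in\mathbb N^N$ and $\mathcal B=\{a^\alpha \mid \alpha\in\mathbb N^N\}$. Order the generators by $z_{kl}\prec z_{ij}$ iff $k<i$, or $k=i$ and $l<j$. Writing each element of $\mathcal B$ as the nonincreasing word $z_{i_1j_1}z_{i_2j_2}\cdots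 z_{i_mj_m}$ of its factors, let $\prec$ on $\mathcal B$ be the dictionary ordering of these words, a proper initial segment of a word (in particular the empty word $1$) being smaller than the word. Then $M_q(n)$ is a solvable polynomial algebra with respect to $a_1,\dots,a_N$ and $\prec$, that is: 1. (PBW basis) The monomials $a^\alpha$, $\alpha\in\mathbb N^N$, are pairwise distinct and form a $K$-basis of $M_q(n)$. For $f\neq0$ let $\mathbf{LM}(f)$ denote the $\prec$-largest monomial occurring in $f$ with nonzero coefficient. 2. (Monomial ordering) $\prec$ is a total ordering and a well-ordering on $\mathcal B$, and for all $\alpha,\beta,\gamma,\eta\in\mathbb N^N$: - if $a^\gamma\ne1$, $a^\beta\neq a^\gamma$, $a^\alpha a^\beta a^\eta\ne0$ and $a^\gamma=\mathbf{LM}(a^\alpha a^\beta a^\eta)$, then $a^\beta\prec a^\gamma$; - if $a^\alpha\prec a^\beta$, $a^\gamma a^\alpha a^\eta\neq0$, $a^\gamma a^\beta a^\eta\ne0$ and $\mathbf{LM}(a^\gamma a^\beta a^\eta)\neq1$, then $\mathbf{LM}(a^\gamma a^\alpha a^\eta)\prec\mathbf{LM}(a^\gamma a^\beta a^\eta)$.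 3. (Commutation relations) For all $1\le i<j\le N$ there are $\lambda_{ji}\in K\setminus\{0\}$ and $f_{ji}\in M_q(n)$ with $a_ja_i=\lambda_{ji}a_ia_j+f_{ji}$, and $\mathbf{LM}(f_{ji})\prec a_ia_j$ whenever $f_{ji}\ne0$. In particular, $M_q(n)$ is a solvable polynomial algebra over $K$ in the sense of Kandri-Rody–Weispfenning, i.e. there exist finitely many generators and an ordering of the corresponding monomials for which 1, 2 and 3 hold. -/

import Mathlib

namespace SolvablePoly

/-- The monomial `a_1 ^ α_1 * a_2 ^ α_2 * ⋯ * a_N ^ α_N` (ordered product). -/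
def monomial {A : Type*} [Ring A] {N : ℕ} (a : Fin N → A) (α : Fin N → ℕ) : A :=
  (List.ofFn fun i => a i ^ α i).prod

/-- `A = K[a_1, …, a_N]` has the PBW basis `{a_1 ^ α_1 ⋯ a_N ^ α_N | α ∈ ℕ ^ N}`: the
monomials, as a family indexed by the exponents, are linearly independent and span `A`. -/
structure IsPBWBasis (K : Type*) {A : Type*} [Field K] [Ring A] [Algebra K A] {N : ℕ}
    (a : Fin N → A) : Prop where
  linearIndependent : LinearIndependent K (monomial a)
  span_eq_top : Submodule.span K (Set.range (monomial a)) = ⊤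

/-- `LM(f) = a ^ γ`: the element `f` has an expression as a linear combination `c` of monomials
in which `a ^ γ` occurs with a nonzero coefficient and in which every other monomial that occurs
is smaller than `a ^ γ`. A monomial is given by its exponent, `r` is the ordering.
The zero element has no leading monomial. -/
def IsLM (K : Type*) {A : Type*} [Field K] [Ring A] [Algebra K A] {N : ℕ}
    (a : Fin N → A) (r : (Fin N → ℕ) → (Fin N → ℕ) → Prop) (f : A) (γ : Fin N → ℕ) : Prop :=
  ∃ c : (Fin N → ℕ) →₀ K, f = Finsupp.linearCombination K (monomial a) c ∧
    γ ∈ c.support ∧ ∀ δ ∈ c.support, δ ≠ γ → r δ γ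

/-- `r` is a monomial ordering on the PBW basis of `A = K[a_1, …, a_N]`, where the relation
`r α β` between exponents means `a ^ α ≺ a ^ β`. (It is used together with `IsPBWBasis`, so that
monomials and exponents correspond bijectively.) -/
structure IsMonomialOrdering (K : Type*) {A : Type*} [Field K] [Ring A] [Algebra K A] {N : ℕ}
    (a : Fin N → A) (r : (Fin N → ℕ) → (Fin N → ℕ) → Prop) : Prop where
  total : IsStrictTotalOrder (Fin N → ℕ) r
  wellFounded : WellFounded r
  lt_of_isLM : ∀ γ α β η : Fin N → ℕ, monomial a γ ≠ 1 → monomial a β ≠ monomial a γ →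
    IsLM K a r (monomial a α * monomial a β * monomial a η) γ → r β γ
  mul_lt_mul : ∀ γ α β η μ ν : Fin N → ℕ, r α β →
    IsLM K a r (monomial a γ * monomial a α * monomial a η) μ →
    IsLM K a r (monomial a γ * monomial a β * monomial a η) ν →
    monomial a ν ≠ 1 → r μ ν

/-- `A = K[a_1, …, a_N]` is a solvable polynomial algebra with respect to the generators
`a_1, …, a_N` and the ordering `r` of the monomials: for `i < j` there are `c ≠ 0` in `K` and
`f ∈ A` with `a_j a_i = c a_i a_j + f` and `LM(f) ≺ a_i a_j` whenever `f ≠ 0`. The exponent of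
the monomial `a_i a_j` is `Pi.single i 1 + Pi.single j 1`. -/
structure IsSolvableWith (K : Type*) {A : Type*} [Field K] [Ring A] [Algebra K A] {N : ℕ}
    (a : Fin N → A) (r : (Fin N → ℕ) → (Fin N → ℕ) → Prop) : Prop where
  isPBWBasis : IsPBWBasis K a
  isMonomialOrdering : IsMonomialOrdering K a r
  relations : ∀ i j : Fin N, i < j → ∃ c : K, c ≠ 0 ∧ ∃ f : A,
    a j * a i = c • (a i * a j) + f ∧
    (f ≠ 0 → ∃ μ, IsLM K a r f μ ∧ r μ (Pi.single i 1 + Pi.single j 1))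

/-- `A` is a solvable polynomial algebra over `K`. -/
def IsSolvablePolynomialAlgebra (K A : Type*) [Field K] [Ring A] [Algebra K A] : Prop :=
  ∃ (N : ℕ) (a : Fin N → A) (r : (Fin N → ℕ) → (Fin N → ℕ) → Prop), IsSolvableWith K a r

end SolvablePoly

namespace QuantumMatrix

/-- The defining relations of the standard quantized matrix algebra, in the free algebra on
the letters `(i, j)`. -/
inductive Rel {K : Type*} [Field K] (n : ℕ) (q : K) :
    FreeAlgebra K (Fin n × Fin n) → FreeAlgebra K (Fin n × Fin n) → Prop
  | row (i j k : Fin n) (h : j < k) : Rel n q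
      (FreeAlgebra.ι K (i, j) * FreeAlgebra.ι K (i, k))
      (q • (FreeAlgebra.ι K (i, k) * FreeAlgebra.ι K (i, j)))
  | col (i j k : Fin n) (h : i < k) : Rel n q
      (FreeAlgebra.ι K (i, j) * FreeAlgebra.ι K (k, j))
      (q • (FreeAlgebra.ι K (k, j) * FreeAlgebra.ι K (i, j)))
  | anti (i j s t : Fin n) (h : i < s) (h' : t < j) : Rel n q
      (FreeAlgebra.ι K (i, j) * FreeAlgebra.ι K (s, t))
      (FreeAlgebra.ι K (s, t) * FreeAlgebra.ι K (i, j))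
  | diag (i j s t : Fin n) (h : i < s) (h' : j < t) : Rel n q
      (FreeAlgebra.ι K (i, j) * FreeAlgebra.ι K (s, t))
      (FreeAlgebra.ι K (s, t) * FreeAlgebra.ι K (i, j) +
        (q - q⁻¹) • (FreeAlgebra.ι K (i, t) * FreeAlgebra.ι K (s, j)))

/-- The standard quantized matrix algebra `M_q(n)`: the free algebra modulo the two-sided ideal
generated by the relations. -/
abbrev Mq {K : Type*} [Field K] (n : ℕ) (q : K) : Type _ :=
  RingQuot (Rel n q)

/-- The generator `z_{ij}` of `M_q(n)`. -/
def z {K : Type*} [Field K] (n : ℕ) (q : K) (p : Fin n × Fin n) : Mq n q :=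
  RingQuot.mkAlgHom K (Rel n q) (FreeAlgebra.ι K p)

/-- The `k`-th index pair when the pairs are listed in decreasing lexicographic order
`(n, n), (n, n - 1), …, (n, 1), (n - 1, n), …, (1, 1)`. (The map `finProdFinEquiv` sends `(i, j)`,
counted from `0`, to `j + n * i`.) -/
def pair (n : ℕ) (k : Fin (n * n)) : Fin n × Fin n :=
  finProdFinEquiv.symm (Fin.rev k)

/-- The generators of `M_q(n)` listed as `z_{nn}, z_{n,n-1}, …, z_{n1}, z_{n-1,n}, …, z_{11}`. -/
def gen {K : Type*} [Field K] (n : ℕ) (q : K) (k : Fin (n * n)) : Mq n q :=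
  z n q (pair n k)

/-- `z_p ≺ z_p'` for generators: the lexicographic ordering of the index pairs. -/
def genLT (n : ℕ) (p p' : Fin n × Fin n) : Prop :=
  p.1 < p'.1 ∨ p.1 = p'.1 ∧ p.2 < p'.2

/-- The nonincreasing word `z_{i_1 j_1} z_{i_2 j_2} ⋯ z_{i_k j_k}` (as its list of index pairs)
that spells out the monomial `z_{nn} ^ α_1 ⋯ z_{11} ^ α_{n²}`. -/
def word (n : ℕ) (α : Fin (n * n) → ℕ) : List (Fin n × Fin n) :=
  (List.finRange (n * n)).flatMap fun k => List.replicate (α k) (pair n k)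

/-- The ordering of the PBW monomials: the lexicographic (dictionary) ordering of their
nonincreasing words, in which a proper prefix of a word is smaller than the word. -/
def monLT (n : ℕ) (α β : Fin (n * n) → ℕ) : Prop :=
  List.Lex (genLT n) (word n α) (word n β)

end QuantumMatrix

/-! Everything is reduced to the lexicographic order on exponents. Since nonincreasing words are
compared letter by letter and earlier generators are larger, the dictionary order is this order
(`monLT_eq_lexLT`), which is a well-order compatible with addition.

Spanning and the ordering axioms come from straightening. Swapping two generators costs a nonzero
scalar and an error of smaller exponent (`commutesModLower_gen`), so a word equals a nonzero
multiple of its sorted monomial modulo smaller monomials (`wordProd_sub_mem_below`). Once the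
monomials are independent, leading exponents are unique and add under multiplication.

Independence needs a model, built by adding one row at a time
(`exists_isQMatrix_linearIndependent`). Given operators on `V` satisfying the relations for `m`
rows, pass to Laurent polynomials in `y` with coefficients in `V`. The new last row acts by quantum
affine coordinates, and the old rows are multiplied by an L-operator so that the relations persist
(`IsQMatrix.snoc`). On `y ^ 0` the L-operator is the identity matrix, so the old rows act there as
before. The new row, applied last, then records its exponents in the power of `y`. -/

namespace SolvablePoly

/-! ### Straightening words modulo lexicographically smaller monomials -/

section Straightening

variable {K A : Type*} [Field K] [Ring A] [Algebra K A] {N : ℕ} (a : Fin N → A)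

/-- The product of the generators along a word. -/
def wordProd (w : List (Fin N)) : A := (w.map a).prod

/-- The exponent of a word, in the lexicographically ordered monoid of exponents. -/
def exponent (w : List (Fin N)) : Lex (Fin N → ℕ) := toLex fun i => w.count i

/-- The sorted word with a given exponent. -/
def sortedWord (α : Fin N → ℕ) : List (Fin N) :=
  (List.finRange N).flatMap fun i => List.replicate (α i) i

/-- The span of the monomials whose exponent is smaller than `γ`. -/
def below (K : Type*) {A : Type*} [Field K] [Ring A] [Algebra K A] {N : ℕ} (a : Fin N → A)
    (γ : Lex (Fin N → ℕ)) : Submodule K A :=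
  Submodule.span K (monomial a '' {δ | toLex δ < γ})

lemma below_mono {γ γ' : Lex (Fin N → ℕ)} (h : γ ≤ γ') : below K a γ ≤ below K a γ' :=
  Submodule.span_mono (Set.image_mono fun _ hδ => lt_of_lt_of_le hδ h)

lemma monomial_mem_below {δ : Fin N → ℕ} {γ : Lex (Fin N → ℕ)} (h : toLex δ < γ) :
    monomial a δ ∈ below K a γ :=
  Submodule.subset_span ⟨δ, h, rfl⟩

lemma toLex_nonneg (α : Lex (Fin N → ℕ)) : 0 ≤ α :=
  Pi.toLex_monotone (a := 0) (b := ofLex α) (fun _ => Nat.zero_le _)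

lemma exponent_append (u v : List (Fin N)) : exponent (u ++ v) = exponent u + exponent v := by
  apply ofLex.injective
  funext i
  exact List.count_append

lemma exponent_cons (i : Fin N) (v : List (Fin N)) :
    exponent (i :: v) = exponent [i] + exponent v :=
  exponent_append [i] v

lemma exponent_perm {u v : List (Fin N)} (h : u.Perm v) : exponent u = exponent v := by
  unfold exponent
  congr 1
  funext i
  exact h.count_eq i

lemma exponent_pair (i j : Fin N) :
    exponent [i, j] = toLex (Pi.single i 1 + Pi.single j 1) := by
  apply ofLex.injective
  funext k
  simp only [exponent, List.count_cons, List.count_nil, ofLex_toLex, Pi.add_apply, Pi.single_apply,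
    beq_iff_eq, eq_comm (a := k)]
  ring

lemma wordProd_append (u v : List (Fin N)) :
    wordProd a (u ++ v) = wordProd a u * wordProd a v := by
  simp [wordProd]

lemma wordProd_sortedWord (α : Fin N → ℕ) : wordProd a (sortedWord α) = monomial a α := by
  unfold wordProd sortedWord monomial
  rw [List.ofFn_eq_map]
  induction List.finRange N with
  | nil => simp
  | cons i l ih => simp [ih]

lemma exponent_sortedWord (α : Fin N → ℕ) : exponent (sortedWord α) = toLex α := by
  unfold exponent sortedWord
  congr 1
  funext i
  have h : ∀ l : List (Fin N), l.Nodup →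
      (l.flatMap fun k => List.replicate (α k) k).count i = if i ∈ l then α i else 0 := by
    intro l hl
    induction l with
    | nil => simp
    | cons k l ih =>
      rw [List.nodup_cons] at hl
      rw [List.flatMap_cons, List.count_append, ih hl.2, List.count_replicate]
      by_cases hk : k = i
      · subst hk
        simp [hl.1]
      · simp [hk, Ne.symm hk]
  simpa using h _ (List.nodup_finRange N)

lemma pairwise_sortedWord (α : Fin N → ℕ) : (sortedWord α).Pairwise (· ≤ ·) := by
  unfold sortedWord
  have h : ∀ l : List (Fin N), l.Pairwise (· < ·) →
      (l.flatMap fun k => List.replicate (α k) k).Pairwise (· ≤ ·) := by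
    intro l hl
    induction l with
    | nil => simp
    | cons k l ih =>
      rw [List.pairwise_cons] at hl
      rw [List.flatMap_cons, List.pairwise_append]
      refine ⟨by simp [List.pairwise_replicate], ih hl.2, ?_⟩
      intro x hx y hy
      rw [List.mem_flatMap] at hy
      obtain ⟨k', hk', hy⟩ := hy
      rw [List.eq_of_mem_replicate hx, List.eq_of_mem_replicate hy]
      exact (hl.1 k' hk').le
  exact h _ (List.pairwise_lt_finRange N)

lemma perm_sortedWord (w : List (Fin N)) : w.Perm (sortedWord (ofLex (exponent w))) := by
  rw [List.perm_iff_count]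
  intro i
  have h := exponent_sortedWord (ofLex (exponent w))
  exact (congrFun (congrArg ofLex h) i).symm

lemma monomial_exponent_of_pairwise {w : List (Fin N)} (h : w.Pairwise (· ≤ ·)) :
    monomial a (ofLex (exponent w)) = wordProd a w := by
  rw [← wordProd_sortedWord]
  congr 1
  exact ((perm_sortedWord w).eq_of_pairwise' h (pairwise_sortedWord _)).symm

variable {a}

/-- Adding exponents on either side preserves strict inequality, so an error term stays an error
term inside a longer word. The bound by `γ` keeps the resulting words within reach of the induction
hypothesis. -/
lemma wordProd_mul_mem_below {γ : Lex (Fin N → ℕ)}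
    (ih : ∀ w, exponent w < γ → ∀ γ', exponent w < γ' → wordProd a w ∈ below K a γ')
    (u v : List (Fin N)) {δ : Lex (Fin N → ℕ)} (hδ : exponent u + δ + exponent v ≤ γ) {x : A}
    (hx : x ∈ below K a δ) :
    wordProd a u * x * wordProd a v ∈ below K a (exponent u + δ + exponent v) := by
  unfold below at hx
  induction hx using Submodule.span_induction with
  | mem x hx =>
    obtain ⟨ε, hε, rfl⟩ := hx
    rw [← wordProd_sortedWord, ← wordProd_append, ← wordProd_append]
    have : exponent (u ++ sortedWord ε ++ v) < exponent u + δ + exponent v := by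
      rw [exponent_append, exponent_append, exponent_sortedWord]
      exact add_lt_add_left (add_lt_add_right hε _) _
    exact ih _ (this.trans_le hδ) _ this
  | zero => simp
  | add x y _ _ hx hy => rw [mul_add, add_mul]; exact add_mem hx hy
  | smul c x _ hx =>
    rw [mul_smul_comm, smul_mul_assoc]
    exact Submodule.smul_mem _ _ hx

/-- The generators commute up to nonzero scalars and smaller monomials. -/
def CommutesModLower (K : Type*) {A : Type*} [Field K] [Ring A] [Algebra K A] {N : ℕ}
    (a : Fin N → A) : Prop :=
  ∀ i j, i < j → ∃ c : K, c ≠ 0 ∧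
    a j * a i - c • (a i * a j) ∈ below K a (toLex (Pi.single i 1 + Pi.single j 1))

/-- A permutation is a chain of adjacent swaps. Each swap contributes a nonzero scalar, and all
errors lie below the same exponent because permuting letters does not change it. -/
lemma wordProd_perm (hrel : CommutesModLower K a) {γ : Lex (Fin N → ℕ)}
    (ih : ∀ w, exponent w < γ → ∀ γ', exponent w < γ' → wordProd a w ∈ below K a γ')
    {w w' : List (Fin N)} (hw : w.Perm w') (hγ : exponent w ≤ γ) :
    ∃ c : K, c ≠ 0 ∧ wordProd a w - c • wordProd a w' ∈ below K a (exponent w) := by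
  induction hw with
  | nil => exact ⟨1, one_ne_zero, by simp⟩
  | @cons i l l' h IH =>
    rw [exponent_cons] at hγ ⊢
    have h0 : 0 ≤ exponent [i] := toLex_nonneg _
    obtain ⟨c, hc, hmem⟩ := IH (le_trans (le_add_of_nonneg_left h0) hγ)
    refine ⟨c, hc, ?_⟩
    have e0 : exponent ([] : List (Fin N)) = 0 := rfl
    have h2 := wordProd_mul_mem_below ih [i] [] (δ := exponent l)
      (by rw [e0, add_zero]; exact hγ) hmem
    rw [e0, add_zero] at h2
    simpa [wordProd, mul_sub] using h2
  | swap x y l =>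
    have key : ∃ c : K, c ≠ 0 ∧ a y * a x - c • (a x * a y) ∈ below K a (exponent [y, x]) := by
      rcases lt_trichotomy x y with h | h | h
      · rw [exponent_perm (List.Perm.swap x y []), exponent_pair]
        exact hrel x y h
      · subst h
        exact ⟨1, one_ne_zero, by simp⟩
      · obtain ⟨c, hc, hmem⟩ := hrel y x h
        refine ⟨c⁻¹, inv_ne_zero hc, ?_⟩
        rw [exponent_pair]
        -- The letters are already in order here, so the commutation relation is read backwards;
        -- this is where `c ≠ 0` is needed.
        have : a y * a x - c⁻¹ • (a x * a y) = -c⁻¹ • (a x * a y - c • (a y * a x)) := by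
          rw [smul_sub, smul_smul, neg_mul, inv_mul_cancel₀ hc]
          simp [sub_eq_add_neg, add_comm]
        rw [this]
        exact Submodule.smul_mem _ _ hmem
    obtain ⟨c, hc, hmem⟩ := key
    refine ⟨c, hc, ?_⟩
    have e0 : exponent ([] : List (Fin N)) = 0 := rfl
    have e1 : exponent (y :: x :: l) = exponent [y, x] + exponent l := exponent_append [y, x] l
    have h2 := wordProd_mul_mem_below ih [] l (δ := exponent [y, x])
      (by rw [e0, zero_add, ← e1]; exact hγ) hmem
    rw [e0, zero_add, ← e1] at h2
    simpa [wordProd, sub_mul, mul_assoc] using h2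
  | @trans l₁ l₂ l₃ h12 h23 IH1 IH2 =>
    obtain ⟨c, hc, hm⟩ := IH1 hγ
    rw [exponent_perm h12] at hγ hm ⊢
    obtain ⟨d, hd, hm'⟩ := IH2 hγ
    refine ⟨c * d, mul_ne_zero hc hd, ?_⟩
    have := add_mem hm (Submodule.smul_mem _ c hm')
    rwa [smul_sub, smul_smul, sub_add_sub_cancel] at this

/-- Well-founded induction on the exponent: sorting the word creates only errors of smaller
exponent, which are already under control. -/
theorem wordProd_sub_mem_below (hrel : CommutesModLower K a) (w : List (Fin N)) :
    ∃ c : K, c ≠ 0 ∧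
      wordProd a w - c • monomial a (ofLex (exponent w)) ∈ below K a (exponent w) := by
  obtain ⟨γ, hγ⟩ : ∃ γ, exponent w = γ := ⟨_, rfl⟩
  induction γ using WellFoundedLT.induction generalizing w with
  | ind γ ih =>
    have ih' : ∀ w, exponent w < γ → ∀ γ', exponent w < γ' → wordProd a w ∈ below K a γ' := by
      intro w hw γ' hγ'
      obtain ⟨c, -, hc⟩ := ih _ hw w rfl
      have h1 := below_mono a hγ'.le hc
      have h2 : c • monomial a (ofLex (exponent w)) ∈ below K a γ' :=
        Submodule.smul_mem _ _ (monomial_mem_below a hγ')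
      simpa using add_mem h1 h2
    obtain ⟨c, hc, hm⟩ := wordProd_perm hrel ih' (perm_sortedWord w) hγ.le
    exact ⟨c, hc, by rwa [wordProd_sortedWord] at hm⟩

theorem span_monomial_eq_top (hrel : CommutesModLower K a)
    (hgen : Algebra.adjoin K (Set.range a) = ⊤) :
    Submodule.span K (Set.range (monomial a)) = ⊤ := by
  rw [eq_top_iff, ← Algebra.top_toSubmodule, ← hgen, Algebra.adjoin_eq_span, Submodule.span_le]
  intro x hx
  obtain ⟨l, hl, rfl⟩ := Submonoid.exists_list_of_mem_closure hx
  obtain ⟨w, rfl⟩ : ∃ w : List (Fin N), w.map a = l := by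
    clear hx
    induction l with
    | nil => exact ⟨[], rfl⟩
    | cons y l ih =>
      obtain ⟨i, rfl⟩ := hl y (by simp)
      obtain ⟨w, rfl⟩ := ih fun z hz => hl z (by simp [hz])
      exact ⟨i :: w, rfl⟩
  obtain ⟨c, -, hc⟩ := wordProd_sub_mem_below hrel w
  have h1 : below K a (exponent w) ≤ Submodule.span K (Set.range (monomial a)) :=
    Submodule.span_mono (Set.image_subset_range _ _)
  have h2 := add_mem (h1 hc) (Submodule.smul_mem _ c
    (Submodule.subset_span (Set.mem_range_self (ofLex (exponent w)))))
  simpa [wordProd] using h2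

lemma IsLM.unique {r : (Fin N → ℕ) → (Fin N → ℕ) → Prop} [Std.Asymm r]
    (hli : LinearIndependent K (monomial a)) {f : A} {μ ν : Fin N → ℕ}
    (hμ : IsLM K a r f μ) (hν : IsLM K a r f ν) : μ = ν := by
  obtain ⟨c, hc, hcμ, hc'⟩ := hμ
  obtain ⟨d, hd, hdν, hd'⟩ := hν
  obtain rfl : c = d := hli (hc.symm.trans hd)
  by_contra h
  exact Std.Asymm.asymm _ _ (hc' ν hdν (Ne.symm h)) (hd' μ hcμ h)

/-- The lexicographic ordering of exponents, as a relation on the exponents themselves. -/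
def lexLT {N : ℕ} (α β : Fin N → ℕ) : Prop := toLex α < toLex β

lemma isLM_of_sub_mem_below {f : A} {γ : Fin N → ℕ} {c : K} (hc : c ≠ 0)
    (h : f - c • monomial a γ ∈ below K a (toLex γ)) : IsLM K a lexLT f γ := by
  unfold below at h
  rw [Finsupp.mem_span_image_iff_linearCombination] at h
  obtain ⟨d, hd, hde⟩ := h
  rw [Finsupp.mem_supported] at hd
  -- No cancellation can occur at `γ`: the error involves only strictly smaller exponents.
  have hdγ : d γ = 0 := by
    by_contra h0
    exact lt_irrefl (toLex γ) (hd (Finsupp.mem_support_iff.mpr h0))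
  refine ⟨d + Finsupp.single γ c, ?_, ?_, ?_⟩
  · rw [map_add, hde, Finsupp.linearCombination_single, sub_add_cancel]
  · simp [hdγ, hc]
  · intro δ hδ hne
    refine hd (a := δ) ?_
    rw [Finsupp.mem_support_iff] at hδ
    simpa [Finsupp.single_apply, Ne.symm hne] using hδ

lemma isLM_mul_mul (hrel : CommutesModLower K a) (α β η : Fin N → ℕ) :
    IsLM K a lexLT (monomial a α * monomial a β * monomial a η) (α + β + η) := by
  obtain ⟨c, hc, h⟩ := wordProd_sub_mem_below hrel (sortedWord α ++ sortedWord β ++ sortedWord η)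
  rw [wordProd_append, wordProd_append, exponent_append, exponent_append] at h
  simp only [wordProd_sortedWord, exponent_sortedWord] at h
  exact isLM_of_sub_mem_below hc h

/-- By straightening, a product of three monomials has the sum of their exponents as leading
exponent. Both multiplicative axioms thus become facts about the ordered monoid of exponents. -/
theorem isMonomialOrdering_lexLT (hrel : CommutesModLower K a)
    (hli : LinearIndependent K (monomial a)) : IsMonomialOrdering K a lexLT := by
  have hord : IsStrictTotalOrder (Fin N → ℕ) lexLT :=
    { trichotomous := fun α β h1 h2 =>
        toLex.injective (le_antisymm (not_lt.mp h2) (not_lt.mp h1))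
      irrefl := fun α => lt_irrefl (toLex α)
      trans := fun α β γ => lt_trans (a := toLex α) (b := toLex β) (c := toLex γ) }
  have hasymm : Std.Asymm (lexLT (N := N)) := ⟨fun α β => lt_asymm (a := toLex α) (b := toLex β)⟩
  refine ⟨hord, ?_, ?_, ?_⟩
  · exact InvImage.wf toLex wellFounded_lt
  · intro γ α β η _ hne hLM
    obtain rfl := hLM.unique hli (isLM_mul_mul hrel α β η)
    refine lt_of_le_of_ne ?_ fun h => hne (congrArg (monomial a) (toLex.injective h))
    have h1 : (0 : Lex (Fin N → ℕ)) ≤ toLex α := toLex_nonneg _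
    have h2 : (0 : Lex (Fin N → ℕ)) ≤ toLex η := toLex_nonneg _
    calc toLex β ≤ toLex α + toLex β := le_add_of_nonneg_left h1
      _ ≤ toLex α + toLex β + toLex η := le_add_of_nonneg_right h2
  · intro γ α β η μ ν hαβ hμ hν _
    obtain rfl := hμ.unique hli (isLM_mul_mul hrel γ α η)
    obtain rfl := hν.unique hli (isLM_mul_mul hrel γ β η)
    exact add_lt_add_left (a := toLex η) (add_lt_add_right (a := toLex γ) hαβ)

end Straightening

end SolvablePoly

namespace QuantumMatrix

/-! ### R-matrix relations and the scalar identity behind the L-operator -/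

section Scalars

variable {K : Type*} [Field K] (q : K)

/-- Diagonal coefficient of the R-matrix. -/
def rDiag {ι : Type*} [DecidableEq ι] (i s : ι) : K := if i = s then q else 1

/-- Off-diagonal coefficient of the R-matrix. -/
def rOff {ι : Type*} [LT ι] [DecidableLT ι] (i s : ι) : K := if i < s then q - q⁻¹ else 0

/-- The R-matrix form `R X₁ X₂ = X₂ X₁ R` of the quantum matrix relations. -/
def IsQMatrix {ι κ B : Type*} [LinearOrder ι] [LinearOrder κ] [Ring B] [Algebra K B]
    (X : ι → κ → B) : Prop :=
  ∀ i s j t, rDiag q i s • (X s j * X i t) + rOff q i s • (X i j * X s t) =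
    rDiag q j t • (X i t * X s j) + rOff q j t • (X i j * X s t)

/-- Scalar by which the `(l, j)` entry of the L-operator acts on a weight vector, `E k` and `F k`
being the values there of `q ^ a k` and `q ^ ∑ i < k, a i`. -/
def lScalar {ι : Type*} [LinearOrder ι] (E F : ι → K) (l j : ι) : K :=
  if l = j then E j else if j < l then (E l ^ 2 - 1) * F l / (q * F j * E j) else 0

/-- The change of `q ^ a` under `a ↦ a + e_t - e_p`. -/
def shiftE {ι : Type*} [LinearOrder ι] (E : ι → K) (t p : ι) (k : ι) : K :=
  E k * (if k = t then q else 1) / (if k = p then q else 1)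

/-- The change of `q ^ ∑ i < k, a i` under `a ↦ a + e_t - e_p`. -/
def shiftF {ι : Type*} [LinearOrder ι] (F : ι → K) (t p : ι) (k : ι) : K :=
  F k * (if t < k then q else 1) / (if p < k then q else 1)

lemma trichotomy {ι : Type*} [LinearOrder ι] (a b : ι) :
    (a < b ∧ ¬ b < a ∧ a ≠ b ∧ b ≠ a) ∨ a = b ∨ (b < a ∧ ¬ a < b ∧ a ≠ b ∧ b ≠ a) := by
  rcases lt_trichotomy a b with h | h | h
  · exact Or.inl ⟨h, h.not_gt, h.ne, h.ne'⟩
  · exact Or.inr (Or.inl h)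
  · exact Or.inr (Or.inr ⟨h, h.not_gt, h.ne', h.ne⟩)

variable {q}

-- These are the quantum matrix relations of the L-operator, read off on one weight vector. `E` and
-- `F` may be arbitrary nonvanishing functions, so for each relative order of the four indices only
-- a rational identity is left.
set_option maxHeartbeats 4000000 in
lemma lScalar_rtt (hq : q ≠ 0) {ι : Type*} [LinearOrder ι] (E F : ι → K)
    (hE : ∀ k, E k ≠ 0) (hF : ∀ k, F k ≠ 0) (l p j t : ι) :
    rDiag q l p * (lScalar q (shiftE q E t l) (shiftF q F t l) p j * lScalar q E F l t) +
      rOff q l p * (lScalar q (shiftE q E t p) (shiftF q F t p) l j * lScalar q E F p t) =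
    rDiag q j t * (lScalar q (shiftE q E j p) (shiftF q F j p) l t * lScalar q E F p j) +
      rOff q j t * (lScalar q (shiftE q E t p) (shiftF q F t p) l j * lScalar q E F p t) := by
  have hEl := hE l
  have hEp := hE p
  have hEj := hE j
  have hEt := hE t
  have hFl := hF l
  have hFp := hF p
  have hFj := hF j
  have hFt := hF t
  unfold rDiag rOff lScalar shiftE shiftF
  rcases trichotomy l p with ⟨h1, h1', h1a, h1b⟩ | h1 | ⟨h1, h1', h1a, h1b⟩ <;>
  rcases trichotomy j t with ⟨h2, h2', h2a, h2b⟩ | h2 | ⟨h2, h2', h2a, h2b⟩ <;>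
  rcases trichotomy l j with ⟨h3, h3', h3a, h3b⟩ | h3 | ⟨h3, h3', h3a, h3b⟩ <;>
  rcases trichotomy p j with ⟨h4, h4', h4a, h4b⟩ | h4 | ⟨h4, h4', h4a, h4b⟩ <;>
  first
  | (exfalso; order)
  | (rcases trichotomy l t with ⟨h5, h5', h5a, h5b⟩ | h5 | ⟨h5, h5', h5a, h5b⟩ <;>
      rcases trichotomy p t with ⟨h6, h6', h6a, h6b⟩ | h6 | ⟨h6, h6', h6a, h6b⟩ <;>
      first
      | (exfalso; order)
      | (subst_vars
         first
         | (simp [*, -mul_eq_mul_left_iff, -mul_eq_mul_right_iff]; done)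
         | (simp [*, -mul_eq_mul_left_iff, -mul_eq_mul_right_iff]; field_simp; done)
         | (simp [*, -mul_eq_mul_left_iff, -mul_eq_mul_right_iff]; field_simp; ring)))

end Scalars

end QuantumMatrix

namespace QuantumMatrix

/-! ### Products of quantum matrices and adjoining a row -/

section RowExtension

variable {K : Type*} [Field K] {q : K}

/-- This is the comultiplication: as the entries of `X` and `Y` commute, R can be moved first past
the two copies of `X`, then past those of `Y`. -/
lemma IsQMatrix.mul {ι κ μ B : Type*} [LinearOrder ι] [LinearOrder κ] [Fintype κ] [LinearOrder μ]
    [Ring B] [Algebra K B] {X : ι → κ → B} {Y : κ → μ → B} (hX : IsQMatrix q X)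
    (hY : IsQMatrix q Y) (hXY : ∀ i l k j, Commute (X i l) (Y k j)) :
    IsQMatrix q fun i j => ∑ l, X i l * Y l j := by
  intro i s j t
  have e : ∀ i j s t, (∑ l, X i l * Y l j) * (∑ p, X s p * Y p t) =
      ∑ l, ∑ p, (X i l * X s p) * (Y l j * Y p t) := by
    intro i j s t
    rw [Finset.sum_mul_sum]
    refine Finset.sum_congr rfl fun l _ => Finset.sum_congr rfl fun p _ => ?_
    rw [mul_assoc, ← mul_assoc (Y l j), ← (hXY s p l j).eq]
    simp only [mul_assoc]
  have e' : ∀ i j s t, (∑ l, X i l * Y l j) * (∑ p, X s p * Y p t) =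
      ∑ l, ∑ p, (X i p * X s l) * (Y p j * Y l t) := by
    intro i j s t
    rw [e, Finset.sum_comm]
  have hc : ∀ l p : κ, rDiag q l p = rDiag q p l := fun l p => by
    simp only [rDiag, eq_comm]
  simp only
  rw [e s j i t, e i j s t, e' i t s j]
  simp only [Finset.smul_sum, ← Finset.sum_add_distrib]
  calc _ = ∑ l, ∑ p, (rDiag q i s • (X s l * X i p) + rOff q i s • (X i l * X s p)) *
        (Y l j * Y p t) := by
          simp only [add_mul, smul_mul_assoc]
    _ = ∑ l, ∑ p, ((rDiag q l p • (X i p * X s l)) * (Y l j * Y p t) +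
        (rOff q l p • (X i l * X s p)) * (Y l j * Y p t)) := by
          simp only [hX i s, add_mul]
    _ = ∑ l, ∑ p, (X i l * X s p) * (rDiag q l p • (Y p j * Y l t) +
        rOff q l p • (Y l j * Y p t)) := by
          -- In the diagonal term the summation indices are exchanged, which is harmless because
          -- `rDiag` is symmetric.
          simp only [mul_add, Finset.sum_add_distrib]
          congr 1
          · rw [Finset.sum_comm]
            refine Finset.sum_congr rfl fun l _ => Finset.sum_congr rfl fun p _ => ?_
            rw [hc p l]
            simp only [smul_mul_assoc, mul_smul_comm]
          · simp only [smul_mul_assoc, mul_smul_comm]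
    _ = _ := by
          simp only [hY _ _ j t, mul_add, mul_smul_comm, Finset.sum_add_distrib]
          congr 1
          rw [Finset.sum_comm]

/-- Extending a quantum matrix, transformed by an L-operator, by a new last row. -/
lemma IsQMatrix.snoc {m : ℕ} {κ B : Type*} [LinearOrder κ] [Fintype κ] [Ring B] [Algebra K B]
    {Z : Fin m → κ → B} {S : κ → κ → B} {x : κ → B} (hZ : IsQMatrix q Z) (hS : IsQMatrix q S)
    (hZS : ∀ i l k j, Commute (Z i l) (S k j)) (hZx : ∀ i l j, Commute (Z i l) (x j))
    (hx : ∀ j t, q • (x j * x t) = rDiag q j t • (x t * x j) + rOff q j t • (x j * x t))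
    (hSx : ∀ l j t, x j * S l t + (q - q⁻¹) • (S l j * x t) =
      rDiag q j t • (S l t * x j) + rOff q j t • (S l j * x t))
    (hxS : ∀ l j t, S l j * x t = rDiag q j t • (x t * S l j) + rOff q j t • (x j * S l t)) :
    IsQMatrix q (Fin.snoc (α := fun _ => κ → B) (fun i j => ∑ l, Z i l * S l j) x) := by
  intro i s j t
  have hl : ∀ i j t, x j * (∑ l, Z i l * S l t) = ∑ l, Z i l * (x j * S l t) := by
    intro i j t
    rw [Finset.mul_sum]
    exact Finset.sum_congr rfl fun l _ => by rw [← mul_assoc, ← (hZx i l j).eq, mul_assoc]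
  have hr : ∀ i j t, (∑ l, Z i l * S l t) * x j = ∑ l, Z i l * (S l t * x j) := by
    intro i j t
    rw [Finset.sum_mul]
    exact Finset.sum_congr rfl fun l _ => mul_assoc _ _ _
  induction i using Fin.lastCases with
  | last =>
    induction s using Fin.lastCases with
    | last => simpa [rDiag, rOff] using hx j t
    | cast s =>
      have h : ¬ Fin.last m < s.castSucc := not_lt.mpr (Fin.le_last _)
      simp only [Fin.snoc_last, Fin.snoc_castSucc, hl, hr]
      rw [rDiag, if_neg (Fin.castSucc_ne_last s).symm, rOff, if_neg h, one_smul, zero_smul,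
        add_zero]
      simp only [Finset.smul_sum, ← Finset.sum_add_distrib]
      refine Finset.sum_congr rfl fun l _ => ?_
      rw [hxS l j t, mul_add, mul_smul_comm, mul_smul_comm]
  | cast i =>
    induction s using Fin.lastCases with
    | last =>
      simp only [Fin.snoc_last, Fin.snoc_castSucc, hl, hr]
      rw [rDiag, if_neg (Fin.castSucc_ne_last i), rOff, if_pos (Fin.castSucc_lt_last i), one_smul]
      simp only [Finset.smul_sum, ← Finset.sum_add_distrib]
      refine Finset.sum_congr rfl fun l _ => ?_
      have h := congrArg (Z i l * ·) (hSx l j t)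
      simpa only [mul_add, mul_smul_comm] using h
    | cast s =>
      have h := hZ.mul hS hZS i s j t
      simpa [rDiag, rOff] using h

end RowExtension

/-! ### L-operator and quantum affine space on Laurent polynomials -/

section Operators

variable {K : Type*} [Field K] (q : K) {n : ℕ} {V : Type*} [AddCommGroup V] [Module K V]

/-- The operator `y ^ a ↦ u a • y ^ (a + d)` on Laurent polynomials with coefficients in `V`. -/
noncomputable def monoOp (V : Type*) [AddCommGroup V] [Module K V] (u : (Fin n → ℤ) → K)
    (d : Fin n → ℤ) :
    Module.End K ((Fin n → ℤ) →₀ V) :=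
  Finsupp.lsum ℕ fun a => (u a) • Finsupp.lsingle (a + d)

lemma monoOp_single (u : (Fin n → ℤ) → K) (d a : Fin n → ℤ) (v : V) :
    monoOp V u d (Finsupp.single a v) = Finsupp.single (a + d) (u a • v) := by
  simp [monoOp]

lemma monoOp_mul (u u' : (Fin n → ℤ) → K) (d d' : Fin n → ℤ) :
    monoOp V u d * monoOp V u' d' = monoOp V (fun a => u (a + d') * u' a) (d + d') := by
  refine Finsupp.lhom_ext fun a v => ?_
  rw [Module.End.mul_apply, monoOp_single, monoOp_single, monoOp_single, smul_smul, add_assoc,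
    add_comm d']

lemma monoOp_add (u u' : (Fin n → ℤ) → K) (d : Fin n → ℤ) :
    monoOp V u d + monoOp V u' d = monoOp V (fun a => u a + u' a) d := by
  refine Finsupp.lhom_ext fun a v => ?_
  rw [LinearMap.add_apply, monoOp_single, monoOp_single, monoOp_single, add_smul,
    Finsupp.single_add]

lemma smul_monoOp (c : K) (u : (Fin n → ℤ) → K) (d : Fin n → ℤ) :
    c • monoOp V u d = monoOp V (fun a => c * u a) d := by
  refine Finsupp.lhom_ext fun a v => ?_
  rw [LinearMap.smul_apply, monoOp_single, monoOp_single, mul_smul, Finsupp.smul_single]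

lemma commute_mapRange_monoOp (f : Module.End K V) (u : (Fin n → ℤ) → K) (d : Fin n → ℤ) :
    Commute (Finsupp.mapRange.linearMap f : Module.End K ((Fin n → ℤ) →₀ V)) (monoOp V u d) := by
  refine Finsupp.lhom_ext fun a v => ?_
  simp [Module.End.mul_apply, monoOp_single]

/-- `q ^ a k` -/
noncomputable def qExp (a : Fin n → ℤ) (k : Fin n) : K := q ^ a k

/-- `q ^ ∑ i < k, a i` -/
noncomputable def qPartial (a : Fin n → ℤ) (k : Fin n) : K := q ^ ∑ i ∈ Finset.Iio k, a i

/-- `q ^ ∑ i > k, a i` -/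
noncomputable def xScalar (a : Fin n → ℤ) (k : Fin n) : K :=
  q ^ (∑ i, a i) / (qPartial q a k * qExp q a k)

/-- The entry `(l, j)` of the L-operator. -/
noncomputable def lOp (V : Type*) [AddCommGroup V] [Module K V] (l j : Fin n) :
    Module.End K ((Fin n → ℤ) →₀ V) :=
  monoOp V (fun a => lScalar q (qExp q a) (qPartial q a) l j) (Pi.single j 1 - Pi.single l 1)

/-- Left multiplication by the `j`-th coordinate of quantum affine space. -/
noncomputable def xOp (V : Type*) [AddCommGroup V] [Module K V] (j : Fin n) :
    Module.End K ((Fin n → ℤ) →₀ V) :=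
  monoOp V (fun a => xScalar q a j) (Pi.single j 1)

variable {q}

lemma qExp_add_single (hq : q ≠ 0) (a : Fin n → ℤ) (t : Fin n) :
    qExp q (a + Pi.single t 1) = fun k => qExp q a k * if k = t then q else 1 := by
  funext k
  by_cases h : k = t <;> simp [qExp, zpow_add₀ hq, h]

lemma qPartial_add_single (hq : q ≠ 0) (a : Fin n → ℤ) (t : Fin n) :
    qPartial q (a + Pi.single t 1) = fun k => qPartial q a k * if t < k then q else 1 := by
  funext k
  by_cases h : t < k <;>
    simp [qPartial, Finset.sum_add_distrib, zpow_add₀ hq, Pi.single_apply, h]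

/-- Adding `e_p` back gives `a + e_t`, so the effect of subtracting `e_p` follows by dividing two
instances of the additive rule. -/
lemma qExp_shift (hq : q ≠ 0) (a : Fin n → ℤ) (t p : Fin n) :
    qExp q (a + (Pi.single t 1 - Pi.single p 1)) = shiftE q (qExp q a) t p := by
  have h := qExp_add_single hq (a + (Pi.single t 1 - Pi.single p 1)) p
  rw [add_assoc, sub_add_cancel, qExp_add_single hq] at h
  funext k
  have hk := congrFun h k
  rw [shiftE, hk, mul_div_assoc, div_self (by split_ifs <;> simp [hq]), mul_one]

lemma qPartial_shift (hq : q ≠ 0) (a : Fin n → ℤ) (t p : Fin n) :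
    qPartial q (a + (Pi.single t 1 - Pi.single p 1)) = shiftF q (qPartial q a) t p := by
  have h := qPartial_add_single hq (a + (Pi.single t 1 - Pi.single p 1)) p
  rw [add_assoc, sub_add_cancel, qPartial_add_single hq] at h
  funext k
  have hk := congrFun h k
  rw [shiftF, hk, mul_div_assoc, div_self (by split_ifs <;> simp [hq]), mul_one]

lemma isQMatrix_lOp (hq : q ≠ 0) : IsQMatrix q (lOp q (n := n) V) := by
  intro l p j t
  unfold lOp
  have e1 : (Pi.single j 1 - Pi.single p 1 + (Pi.single t 1 - Pi.single l 1) : Fin n → ℤ) =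
    Pi.single j 1 - Pi.single l 1 + (Pi.single t 1 - Pi.single p 1) := by abel
  have e2 : (Pi.single t 1 - Pi.single l 1 + (Pi.single j 1 - Pi.single p 1) : Fin n → ℤ) =
    Pi.single j 1 - Pi.single l 1 + (Pi.single t 1 - Pi.single p 1) := by abel
  simp only [monoOp_mul, smul_monoOp, e1, e2, monoOp_add]
  congr 1
  funext a
  simp only [qExp_shift hq, qPartial_shift hq]
  exact lScalar_rtt hq _ _ (fun k => zpow_ne_zero _ hq) (fun k => zpow_ne_zero _ hq) l p j t

lemma sum_add_single (a : Fin n → ℤ) (t : Fin n) :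
    ∑ i, (a + (Pi.single t 1 : Fin n → ℤ)) i = ∑ i, a i + 1 := by
  simp [Finset.sum_add_distrib]

lemma sum_shift (a : Fin n → ℤ) (t p : Fin n) :
    ∑ i, (a + ((Pi.single t 1 - Pi.single p 1 : Fin n → ℤ))) i = ∑ i, a i := by
  simp [Finset.sum_add_distrib]

lemma xOp_mul_xOp (hq : q ≠ 0) (j t : Fin n) :
    q • (xOp q V j * xOp q V t) =
      rDiag q j t • (xOp q V t * xOp q V j) + rOff q j t • (xOp q V j * xOp q V t) := by
  unfold xOp
  have e1 : (Pi.single t 1 + Pi.single j 1 : Fin n → ℤ) = Pi.single j 1 + Pi.single t 1 :=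
    add_comm _ _
  simp only [monoOp_mul, smul_monoOp, e1, monoOp_add]
  congr 1
  funext a
  have hE : ∀ k, qExp q a k ≠ 0 := fun k => zpow_ne_zero _ hq
  have hF : ∀ k, qPartial q a k ≠ 0 := fun k => zpow_ne_zero _ hq
  have hEj := hE j
  have hEt := hE t
  have hFj := hF j
  have hFt := hF t
  simp only [xScalar, qExp_add_single hq, qPartial_add_single hq, sum_add_single,
    zpow_add_one₀ hq]
  have hG : q ^ ∑ i, a i ≠ 0 := zpow_ne_zero _ hq
  unfold rDiag rOff
  rcases trichotomy j t with ⟨h, h', ha, hb⟩ | h | ⟨h, h', ha, hb⟩ <;> subst_vars <;>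
    simp [*, -mul_eq_mul_left_iff, -mul_eq_mul_right_iff] <;> field_simp
  ring

lemma lOp_mul_xOp (hq : q ≠ 0) (l j t : Fin n) :
    lOp q V l j * xOp q V t =
      rDiag q j t • (xOp q V t * lOp q V l j) + rOff q j t • (xOp q V j * lOp q V l t) := by
  unfold xOp lOp
  have e1 : (Pi.single t 1 + (Pi.single j 1 - Pi.single l 1) : Fin n → ℤ) =
    Pi.single j 1 - Pi.single l 1 + Pi.single t 1 := by abel
  have e2 : (Pi.single j 1 + (Pi.single t 1 - Pi.single l 1) : Fin n → ℤ) =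
    Pi.single j 1 - Pi.single l 1 + Pi.single t 1 := by abel
  simp only [monoOp_mul, smul_monoOp, e1, e2, monoOp_add]
  congr 1
  funext a
  have hE : ∀ k, qExp q a k ≠ 0 := fun k => zpow_ne_zero _ hq
  have hF : ∀ k, qPartial q a k ≠ 0 := fun k => zpow_ne_zero _ hq
  have hEj := hE j
  have hEt := hE t
  have hFj := hF j
  have hFt := hF t
  have hEl := hE l
  have hFl := hF l
  simp only [xScalar, qExp_add_single hq, qPartial_add_single hq, sum_shift, qExp_shift hq,
    qPartial_shift hq]
  have hG : q ^ ∑ i, a i ≠ 0 := zpow_ne_zero _ hq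
  unfold rDiag rOff lScalar shiftE shiftF
  rcases trichotomy j t with ⟨h, h', ha, hb⟩ | h | ⟨h, h', ha, hb⟩ <;>
  rcases trichotomy l j with ⟨k, k', ka, kb⟩ | k | ⟨k, k', ka, kb⟩ <;>
  rcases trichotomy l t with ⟨r, r', ra, rb⟩ | r | ⟨r, r', ra, rb⟩ <;>
  first
  | (exfalso; order)
  | (subst_vars
     first
     | (simp [*, -mul_eq_mul_left_iff, -mul_eq_mul_right_iff]; done)
     | (simp [*, -mul_eq_mul_left_iff, -mul_eq_mul_right_iff]; field_simp; done)
     | (simp [*, -mul_eq_mul_left_iff, -mul_eq_mul_right_iff]; field_simp; ring))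

/-- No new computation with weights is needed: both products with the L-operator on the left are
rewritten by `lOp_mul_xOp`. -/
lemma xOp_mul_lOp (hq : q ≠ 0) (l j t : Fin n) :
    xOp q V j * lOp q V l t + (q - q⁻¹) • (lOp q V l j * xOp q V t) =
      rDiag q j t • (lOp q V l t * xOp q V j) + rOff q j t • (lOp q V l j * xOp q V t) := by
  rw [lOp_mul_xOp hq l j t, lOp_mul_xOp hq l t j]
  unfold rDiag rOff
  rcases trichotomy j t with ⟨h, h', ha, hb⟩ | h | ⟨h, h', ha, hb⟩
  · simp [*]
  · subst h
    simp only [if_true, lt_irrefl, if_false, zero_smul, add_zero, smul_smul]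
    -- For equal columns only this Hecke-type identity for the scalars remains.
    have h : q * q = 1 + (q - q⁻¹) * q := by
      field_simp
      ring
    rw [h, add_smul, one_smul, zero_mul, zero_smul, add_zero]
  · simp [*]

end Operators

end QuantumMatrix

namespace QuantumMatrix

/-! ### A representation separating the ordered monomials -/

section Independence

variable {K : Type*} [Field K] {q : K}

lemma ofFn_prod_intertwine {V W : Type*} [AddCommGroup V] [Module K V] [AddCommGroup W]
    [Module K W] (L : V →ₗ[K] W) {m : ℕ} (f : Fin m → Module.End K W) (g : Fin m → Module.End K V)
    (h : ∀ i v, f i (L v) = L (g i v)) (v : V) :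
    (List.ofFn f).prod (L v) = L ((List.ofFn g).prod v) := by
  induction m with
  | zero => simp
  | succ m ih =>
    rw [List.ofFn_succ, List.ofFn_succ, List.prod_cons, List.prod_cons, Module.End.mul_apply,
      Module.End.mul_apply, ih _ _ fun i => h i.succ, h]

lemma pow_intertwine {V W : Type*} [AddCommGroup V] [Module K V] [AddCommGroup W]
    [Module K W] (L : V →ₗ[K] W) (f : Module.End K W) (g : Module.End K V)
    (h : ∀ v, f (L v) = L (g v)) (b : ℕ) (v : V) : (f ^ b) (L v) = L ((g ^ b) v) := by
  induction b generalizing v with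
  | zero => simp
  | succ b ih => rw [pow_succ, pow_succ, Module.End.mul_apply, Module.End.mul_apply, h, ih]

lemma xScalar_ne_zero (hq : q ≠ 0) {n : ℕ} (a : Fin n → ℤ) (k : Fin n) : xScalar q a k ≠ 0 :=
  div_ne_zero (zpow_ne_zero _ hq) (mul_ne_zero (zpow_ne_zero _ hq) (zpow_ne_zero _ hq))

lemma xOp_pow_single (hq : q ≠ 0) {n : ℕ} (V : Type*) [AddCommGroup V] [Module K V] (j : Fin n)
    (b : ℕ) (a : Fin n → ℤ) : ∃ c : K, c ≠ 0 ∧ ∀ v : V,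
      (xOp q V j ^ b) (Finsupp.single a v) =
        c • Finsupp.single (a + Pi.single j (b : ℤ)) v := by
  induction b with
  | zero => exact ⟨1, one_ne_zero, by simp⟩
  | succ b ih =>
    obtain ⟨c, hc, h⟩ := ih
    refine ⟨c * xScalar q (a + Pi.single j (b : ℤ)) j,
      mul_ne_zero hc (xScalar_ne_zero hq _ _), fun v => ?_⟩
    rw [pow_succ', Module.End.mul_apply, h, map_smul, xOp, monoOp_single, mul_smul,
      Finsupp.smul_single, add_assoc, ← Pi.single_add]
    rw [Finsupp.smul_single, Finsupp.smul_single, Nat.cast_succ]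

lemma ofFn_xOp_prod_single (hq : q ≠ 0) {n : ℕ} (V : Type*) [AddCommGroup V] [Module K V] {m : ℕ}
    (p : Fin m → Fin n) (b : Fin m → ℕ) (a : Fin n → ℤ) : ∃ c : K, c ≠ 0 ∧ ∀ v : V,
      (List.ofFn fun i => xOp q V (p i) ^ b i).prod (Finsupp.single a v) =
        c • Finsupp.single (a + ∑ i, Pi.single (p i) (b i : ℤ)) v := by
  induction m with
  | zero => exact ⟨1, one_ne_zero, by simp⟩
  | succ m ih =>
    obtain ⟨c, hc, h⟩ := ih (fun i => p i.succ) fun i => b i.succ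
    obtain ⟨d, hd, h'⟩ := xOp_pow_single hq V (p 0) (b 0)
      (a + ∑ i : Fin m, Pi.single (p i.succ) (b i.succ : ℤ))
    refine ⟨c * d, mul_ne_zero hc hd, fun v => ?_⟩
    rw [List.ofFn_succ, List.prod_cons, Module.End.mul_apply, h, map_smul, h', smul_smul,
      Fin.sum_univ_succ, add_assoc, add_comm (∑ i : Fin m, _)]

/-- At weight zero `E` is constantly `1`, so the factor `E l ^ 2 - 1` kills the off-diagonal
entries. -/
lemma lOp_single_zero {n : ℕ} {V : Type*} [AddCommGroup V] [Module K V] (l j : Fin n) (v : V) :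
    lOp q V l j (Finsupp.single 0 v) = if l = j then Finsupp.single 0 v else 0 := by
  rw [lOp, monoOp_single]
  by_cases h : l = j
  · subst h
    simp [lScalar, qExp]
  · simp [lScalar, qExp, h]

/-- The ordered product of the powers of the entries of a matrix, in which larger indices come
first. -/
def orderedProd {B : Type*} [Monoid B] {m n : ℕ} (Z : Fin m → Fin n → B) (β : Fin m → Fin n → ℕ) :
    B :=
  (List.ofFn fun i => (List.ofFn fun j => Z i.rev j.rev ^ β i j).prod).prod

/-- There is a module with a vector on which the ordered products of an `m × n` quantum matrix act
linearly independently. -/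
theorem exists_isQMatrix_linearIndependent.{u} {K : Type u} [Field K] {q : K} (hq : q ≠ 0)
    (m n : ℕ) :
    ∃ (V : Type u) (_ : AddCommGroup V) (_ : Module K V) (Z : Fin m → Fin n → Module.End K V)
      (v : V), IsQMatrix q Z ∧
      LinearIndependent K fun β : Fin m → Fin n → ℕ => orderedProd Z β v := by
  induction m with
  | zero =>
    refine ⟨K, inferInstance, inferInstance, Fin.elim0, 1, fun i => i.elim0, ?_⟩
    rw [linearIndependent_unique_iff]
    simp [orderedProd]
  | succ m ih =>
    obtain ⟨V, _, _, Z, v, hZ, hli⟩ := ih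
    have hZ' : IsQMatrix q fun i l => (Finsupp.mapRange.linearMap (Z i l) :
        Module.End K ((Fin n → ℤ) →₀ V)) := by
      intro i s j t
      refine Finsupp.lhom_ext fun a w => ?_
      have h := congrArg (fun f => Finsupp.single a (f w)) (hZ i s j t)
      simpa [Finsupp.single_add] using h
    have hX := hZ'.snoc (isQMatrix_lOp hq) (fun i l k j => commute_mapRange_monoOp _ _ _)
      (fun i l j => commute_mapRange_monoOp _ _ _) (xOp_mul_xOp hq) (xOp_mul_lOp hq)
      (lOp_mul_xOp hq)
    refine ⟨(Fin n → ℤ) →₀ V, Finsupp.instAddCommGroup, Finsupp.module _ _, _,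
      Finsupp.single 0 v, hX, ?_⟩
    set X := Fin.snoc (α := fun _ => Fin n → Module.End K ((Fin n → ℤ) →₀ V))
      (fun i j => ∑ l, Finsupp.mapRange.linearMap (Z i l) * lOp q V l j) (xOp q V) with hXdef
    -- The copy of `V` in degree zero is stable under the old rows, which act on it by `Z`.
    have hcast : ∀ i j w, X (Fin.castSucc i) j (Finsupp.lsingle (R := K) 0 w) =
        Finsupp.lsingle (R := K) 0 (Z i j w) := by
      intro i j w
      rw [hXdef, Fin.snoc_castSucc, LinearMap.sum_apply, Finset.sum_eq_single j]
      · simp [Module.End.mul_apply, lOp_single_zero]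
      · intro l _ hl
        simp [Module.End.mul_apply, lOp_single_zero, hl]
      · simp
    have hrow : ∀ b : Fin n → ℕ, ∃ c : K, c ≠ 0 ∧ ∀ w : V,
        (List.ofFn fun j => X (Fin.last m) j.rev ^ b j).prod (Finsupp.single 0 w) =
          c • Finsupp.single (fun j => (b j.rev : ℤ)) w := by
      intro b
      obtain ⟨c, hc, h⟩ := ofFn_xOp_prod_single hq V Fin.rev b 0
      refine ⟨c, hc, fun w => ?_⟩
      rw [hXdef, Fin.snoc_last, h, zero_add]
      congr 2
      funext k
      rw [Finset.sum_apply, Finset.sum_eq_single k.rev]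
      · simp
      · intro i _ hi
        rw [Pi.single_apply, if_neg]
        rintro rfl
        simp at hi
      · simp
    choose c hc hrow using hrow
    have hprod : ∀ β : Fin (m + 1) → Fin n → ℕ, orderedProd X β (Finsupp.single 0 v) =
        c (β 0) • Finsupp.single (fun j => (β 0 j.rev : ℤ))
          (orderedProd Z (fun i => β i.succ) v) := by
      intro β
      have h := ofFn_prod_intertwine (Finsupp.lsingle (R := K) (0 : Fin n → ℤ))
        (fun i : Fin m => (List.ofFn fun j => X i.rev.castSucc j.rev ^ β i.succ j).prod)
        (fun i => (List.ofFn fun j => Z i.rev j.rev ^ β i.succ j).prod)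
        (fun i => ofFn_prod_intertwine _ _ _ fun j =>
          pow_intertwine _ _ _ (hcast i.rev j.rev) _) v
      rw [orderedProd, List.ofFn_succ, List.prod_cons, Module.End.mul_apply]
      simp only [Fin.rev_zero, Fin.rev_succ]
      rw [← hrow]
      exact congrArg _ h
    -- Vectors with different last-row exponents lie in different degrees in `y`; within one degree
    -- the induction hypothesis applies. The scalars `c (β 0)` are units and are restored
    -- afterwards.
    have hsig := (Finsupp.linearIndependent_single (R := K) (ι := Fin n → ℤ)
      (φ := fun _ => Fin m → Fin n → ℕ) (fun _ β => orderedProd Z β v) fun _ => hli).comp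
      (fun β : Fin (m + 1) → Fin n → ℕ =>
        (⟨fun j => (β 0 j.rev : ℤ), fun i => β i.succ⟩ :
          Σ _ : Fin n → ℤ, Fin m → Fin n → ℕ)) (by
        intro β β' h
        rw [Sigma.mk.injEq] at h
        obtain ⟨h0, h1⟩ := h
        funext i
        induction i using Fin.cases with
        | zero =>
          funext j
          simpa using congrFun h0 j.rev
        | succ i => exact congrFun (eq_of_heq h1) i)
    have h := hsig.units_smul fun β => Units.mk0 (c (β 0)) (hc (β 0))
    exact (funext hprod).symm ▸ h

end Independence

end QuantumMatrix

namespace QuantumMatrix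

open SolvablePoly

/-! ### The dictionary order is the lexicographic order of exponents -/

section Order

variable {n : ℕ}

lemma genLT_iff (x y : Fin n × Fin n) : genLT n x y ↔ finProdFinEquiv x < finProdFinEquiv y := by
  obtain ⟨i, j⟩ := x
  obtain ⟨s, t⟩ := y
  rw [Fin.lt_def]
  simp only [genLT, finProdFinEquiv_apply_val, Fin.lt_def, Fin.ext_iff]
  have hj := j.isLt
  have ht := t.isLt
  rcases lt_trichotomy (i : ℕ) s with h | h | h
  · have : n * ((i : ℕ) + 1) ≤ n * s := Nat.mul_le_mul_left _ h
    rw [mul_add] at this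
    constructor
    · intro _
      omega
    · intro _
      exact Or.inl h
  · rw [h]
    omega
  · have : n * ((s : ℕ) + 1) ≤ n * i := Nat.mul_le_mul_left _ h
    rw [mul_add] at this
    constructor
    · intro _
      omega
    · intro _
      omega

lemma finProdFinEquiv_pair (k : Fin (n * n)) : finProdFinEquiv (pair n k) = k.rev :=
  finProdFinEquiv.apply_symm_apply _

lemma genLT_pair_iff (k l : Fin (n * n)) : genLT n (pair n k) (pair n l) ↔ l < k := by
  rw [genLT_iff, finProdFinEquiv_pair, finProdFinEquiv_pair, Fin.rev_lt_rev]

lemma monLT_of_lexLT {α β : Fin (n * n) → ℕ} (h : lexLT α β) : monLT n α β := by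
  obtain ⟨k, hk, hlt⟩ := h
  simp only [Pi.toLex_apply] at hk hlt
  obtain ⟨l₁, l₂, hl⟩ := List.append_of_mem (List.mem_finRange k)
  have hp := List.pairwise_lt_finRange (n * n)
  rw [hl, List.pairwise_append, List.pairwise_cons] at hp
  have h1 : (l₁.flatMap fun k => List.replicate (α k) (pair n k)) =
      l₁.flatMap fun k => List.replicate (β k) (pair n k) := by
    refine List.flatMap_congr fun i hi => ?_
    rw [hk i (hp.2.2 i hi k (by simp))]
  -- After the common prefix and `α k` further copies of the `k`-th letter, the word of `β` has one
  -- more such letter. The word of `α` has ended or continues with a later, hence smaller, letter.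
  obtain ⟨d, hd⟩ := Nat.exists_eq_add_of_lt hlt
  unfold monLT word
  rw [hl, List.flatMap_append, List.flatMap_append, h1]
  refine List.Lex.append_left _ ?_ _
  rw [List.flatMap_cons, List.flatMap_cons, hd, add_assoc, List.replicate_add, List.append_assoc]
  refine List.Lex.append_left _ ?_ _
  rw [List.replicate_succ, List.cons_append]
  cases hw : l₂.flatMap fun k => List.replicate (α k) (pair n k) with
  | nil => exact List.Lex.nil
  | cons x w =>
    refine List.Lex.rel ?_
    have hx : x ∈ l₂.flatMap fun k => List.replicate (α k) (pair n k) := by simp [hw]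
    rw [List.mem_flatMap] at hx
    obtain ⟨i, hi, hx⟩ := hx
    rw [List.eq_of_mem_replicate hx, genLT_pair_iff]
    exact hp.2.1.1 i hi

lemma monLT_asymm {α β : Fin (n * n) → ℕ} (h : monLT n α β) : ¬ monLT n β α := by
  have : Std.Asymm (genLT n) := ⟨fun x y h => by
    rw [genLT_iff] at h ⊢
    exact h.not_gt⟩
  exact Std.Asymm.asymm (r := List.Lex (genLT n)) _ _ h

theorem monLT_eq_lexLT : monLT n = lexLT := by
  funext α β
  refine propext ⟨fun h => ?_, monLT_of_lexLT⟩
  -- The converse is formal: a total relation contained in an asymmetric one equals it.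
  rcases lt_trichotomy (toLex α) (toLex β) with h' | h' | h'
  · exact h'
  · obtain rfl := toLex.injective h'
    exact (monLT_asymm h h).elim
  · exact (monLT_asymm h (monLT_of_lexLT h')).elim

end Order

/-! ### The quantized matrix algebra itself -/

section Algebra

variable {K : Type*} [Field K] {n : ℕ} {q : K}

lemma z_row (i : Fin n) {j k : Fin n} (h : j < k) :
    z n q (i, j) * z n q (i, k) = q • (z n q (i, k) * z n q (i, j)) := by
  simpa [z] using RingQuot.mkAlgHom_rel K (Rel.row (q := q) i j k h)

lemma z_col {i k : Fin n} (j : Fin n) (h : i < k) :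
    z n q (i, j) * z n q (k, j) = q • (z n q (k, j) * z n q (i, j)) := by
  simpa [z] using RingQuot.mkAlgHom_rel K (Rel.col (q := q) i j k h)

lemma z_anti {i j s t : Fin n} (h : i < s) (h' : t < j) :
    z n q (i, j) * z n q (s, t) = z n q (s, t) * z n q (i, j) := by
  simpa [z] using RingQuot.mkAlgHom_rel K (Rel.anti (q := q) i j s t h h')

lemma z_diag {i j s t : Fin n} (h : i < s) (h' : j < t) :
    z n q (i, j) * z n q (s, t) =
      z n q (s, t) * z n q (i, j) + (q - q⁻¹) • (z n q (i, t) * z n q (s, j)) := by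
  simpa [z] using RingQuot.mkAlgHom_rel K (Rel.diag (q := q) i j s t h h')

lemma adjoin_range_gen : Algebra.adjoin K (Set.range (gen n q)) = ⊤ := by
  have h1 : Set.range (gen n q) =
      RingQuot.mkAlgHom K (Rel n q) '' Set.range (FreeAlgebra.ι K) := by
    rw [← Set.range_comp]
    have : gen n q = (⇑(RingQuot.mkAlgHom K (Rel n q)) ∘ FreeAlgebra.ι K) ∘ pair n := rfl
    rw [this]
    exact (Fin.revPerm.trans finProdFinEquiv.symm).surjective.range_comp _
  rw [h1, ← AlgHom.map_adjoin, FreeAlgebra.adjoin_range_ι, Algebra.map_top,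
    AlgHom.range_eq_top]
  exact RingQuot.mkAlgHom_surjective K _

/-- For `i < j`, the generators `a_j` and `a_i` commute up to a nonzero scalar and a scalar
multiple of a product `a_k a_l` with `k < l` and smaller leading monomial. -/
lemma gen_mul_gen (hq : q ≠ 0) {i j : Fin (n * n)} (h : i < j) :
    ∃ c : K, c ≠ 0 ∧ (gen n q j * gen n q i = c • (gen n q i * gen n q j) ∨
      ∃ k l, i < k ∧ k < l ∧ l < j ∧ gen n q j * gen n q i =
        c • (gen n q i * gen n q j) + (q - q⁻¹) • (gen n q k * gen n q l)) := by
  have hg : ∀ p : Fin n × Fin n, ∃ k, pair n k = p :=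
    (Fin.revPerm.trans finProdFinEquiv.symm).surjective
  have hlt := (genLT_pair_iff j i).mpr h
  have hr : ∀ k l : Fin (n * n), genLT n (pair n l) (pair n k) → k < l :=
    fun k l => (genLT_pair_iff l k).mp
  -- The index facts are stated through `pair` so that both pairs can be replaced by arbitrary ones
  -- and split into coordinates.
  unfold gen
  revert hlt
  have hri : ∀ k, genLT n (pair n k) (pair n i) → i < k := fun k => hr i k
  have hrj : ∀ k, genLT n (pair n j) (pair n k) → k < j := fun k => hr k j
  revert hri hrj
  generalize pair n i = x
  generalize pair n j = y
  obtain ⟨s, t⟩ := x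
  obtain ⟨i', j'⟩ := y
  intro hri hrj hlt
  rcases hlt with hlt | ⟨heq, hlt⟩
  · rcases lt_trichotomy j' t with h' | h' | h'
    · obtain ⟨l, hl⟩ := hg (i', t)
      obtain ⟨k, hk⟩ := hg (s, j')
      -- The two factors of the correction term lie on an antidiagonal and commute; placing the one
      -- from the larger row first makes it a standard monomial.
      refine ⟨1, one_ne_zero, Or.inr ⟨k, l, hri k ?_, hr k l ?_, hrj l ?_, ?_⟩⟩
      · rw [hk]
        exact Or.inr ⟨rfl, h'⟩
      · rw [hk, hl]
        exact Or.inl hlt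
      · rw [hl]
        exact Or.inr ⟨rfl, h'⟩
      · rw [hk, hl, z_diag hlt h', one_smul, z_anti hlt h']
    · simp only at h' hlt
      subst h'
      exact ⟨q, hq, Or.inl (z_col _ hlt)⟩
    · exact ⟨1, one_ne_zero, Or.inl (by rw [one_smul, z_anti hlt h'])⟩
  · simp only at heq hlt
    subst heq
    exact ⟨q, hq, Or.inl (z_row _ hlt)⟩

lemma gen_mul_gen_eq_monomial {k l : Fin (n * n)} (h : k < l) :
    gen n q k * gen n q l = monomial (gen n q) (Pi.single k 1 + Pi.single l 1) := by
  have h1 := monomial_exponent_of_pairwise (gen n q) (w := [k, l]) (by simpa using h.le)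
  rw [exponent_pair, ofLex_toLex] at h1
  rw [h1]
  simp [wordProd]

lemma lexLT_single_add_single {N : ℕ} {i j k l : Fin N} (hik : i < k) (hkl : k < l) (hlj : l < j) :
    lexLT (Pi.single k 1 + Pi.single l 1) (Pi.single i 1 + Pi.single j 1) := by
  have hil := hik.trans hkl
  refine ⟨i, fun r hr => ?_, ?_⟩
  · simp [hr.ne, (hr.trans hik).ne, (hr.trans hil).ne,
      (hr.trans (hil.trans hlj)).ne]
  · simp [Pi.single_apply, hik.ne, hil.ne]

lemma commutesModLower_gen (hq : q ≠ 0) : CommutesModLower K (gen n q) := by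
  intro i j hij
  obtain ⟨c, hc, h | ⟨k, l, hik, hkl, hlj, h⟩⟩ := gen_mul_gen hq hij
  · exact ⟨c, hc, by rw [h, sub_self]; exact zero_mem _⟩
  · refine ⟨c, hc, ?_⟩
    rw [h, add_sub_cancel_left, gen_mul_gen_eq_monomial hkl]
    exact Submodule.smul_mem _ _ (monomial_mem_below _ (lexLT_single_add_single hik hkl hlj))

lemma IsQMatrix.rel {B : Type*} [Ring B] [Algebra K B] {Z : Fin n → Fin n → B}
    (hZ : IsQMatrix q Z) {x y : FreeAlgebra K (Fin n × Fin n)} (h : Rel n q x y) :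
    FreeAlgebra.lift K (fun p : Fin n × Fin n => Z p.1 p.2) x =
      FreeAlgebra.lift K (fun p : Fin n × Fin n => Z p.1 p.2) y := by
  cases h with
  | row i j k h =>
    have := hZ i i k j
    simpa [rDiag, rOff, h.ne', h.not_gt] using this.symm
  | col i j k h =>
    have := hZ k i j j
    simpa [rDiag, rOff, h.ne', h.not_gt] using this
  | anti i j s t h h' =>
    have := hZ s i j t
    simpa [rDiag, rOff, h.ne', h'.ne', h.not_gt, h'.not_gt] using this
  | diag i j s t h h' =>
    -- The first instance gives the relation with the correction factors in the opposite order; the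
    -- second shows that these factors commute.
    have h1 := hZ s i j t
    have h2 := hZ i s j t
    simp [rDiag, rOff, h.ne', h'.ne, h.not_gt, h', h, h.ne] at h1 h2
    simp [h1, h2]

/-- Reversing the position in the list reverses both coordinates, so the decreasing list splits into
rows, each traversed in decreasing column order. -/
lemma monomial_gen (α : Fin (n * n) → ℕ) :
    monomial (gen n q) α =
      orderedProd (fun i j => z n q (i, j)) fun i j => α (finProdFinEquiv (i, j)) := by
  have hrev : ∀ i j : Fin n, pair n (finProdFinEquiv (i, j)) = (i.rev, j.rev) := by
    intro i j
    rw [pair, Equiv.symm_apply_eq]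
    apply Fin.ext
    have hi := i.isLt
    have hj := j.isLt
    simp only [Fin.val_rev, finProdFinEquiv_apply_val]
    obtain ⟨d, hd⟩ := Nat.exists_eq_add_of_lt hi
    have e : n - (i + 1) = d := by omega
    rw [e]
    have : n * n = n * i + n * d + n := by
      conv_lhs => rw [show n * n = n * (i + d + 1) by rw [← hd]]
      ring
    omega
  unfold monomial orderedProd
  rw [List.ofFn_mul, List.prod_flatten, List.map_ofFn]
  congr 2
  funext i
  simp only [Function.comp]
  congr 2
  funext j
  have : (⟨i * n + j, by
      calc (i : ℕ) * n + j < (i + 1) * n := by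
            rw [add_mul, one_mul]
            exact Nat.add_lt_add_left j.isLt _
        _ ≤ n * n := Nat.mul_le_mul_right _ i.isLt⟩ : Fin (n * n)) = finProdFinEquiv (i, j) := by
    apply Fin.ext
    simp [add_comm, mul_comm]
  rw [this, gen, hrev]

/-- The model with `n` rows is a representation of the algebra. Evaluation at its distinguished
vector is linear and sends the monomials to independent vectors. -/
theorem linearIndependent_monomial_gen (hq : q ≠ 0) :
    LinearIndependent K (monomial (gen n q)) := by
  obtain ⟨V, _, _, Z, v, hZ, hli⟩ := exists_isQMatrix_linearIndependent hq n n
  let φ : Mq n q →ₐ[K] Module.End K V :=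
    RingQuot.liftAlgHom K ⟨FreeAlgebra.lift K fun p : Fin n × Fin n => Z p.1 p.2,
      fun _ _ h => hZ.rel h⟩
  have hφ : ∀ p, φ (z n q p) = Z p.1 p.2 := by
    intro p
    simp [φ, z]
  refine LinearIndependent.of_comp ((LinearMap.applyₗ v).comp φ.toLinearMap) ?_
  have hinj : Function.Injective fun (α : Fin (n * n) → ℕ) (i j : Fin n) =>
      α (finProdFinEquiv (i, j)) := by
    intro α β h
    funext k
    have := congrFun (congrFun h (finProdFinEquiv.symm k).1) (finProdFinEquiv.symm k).2
    simpa only [Prod.mk.eta, Equiv.apply_symm_apply] using this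
  convert hli.comp _ hinj using 1
  funext α
  have : φ (monomial (gen n q) α) = orderedProd Z fun i j => α (finProdFinEquiv (i, j)) := by
    simp [monomial_gen, orderedProd, map_list_prod, List.map_ofFn, Function.comp_def, hφ]
  exact congrArg (· v) this

theorem isSolvableWith_gen (hq : q ≠ 0) : IsSolvableWith K (gen n q) (monLT n) := by
  rw [monLT_eq_lexLT]
  have hli := linearIndependent_monomial_gen (n := n) hq
  have hrel := commutesModLower_gen (n := n) hq
  refine ⟨⟨hli, span_monomial_eq_top hrel adjoin_range_gen⟩, isMonomialOrdering_lexLT hrel hli, ?_⟩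
  intro i j hij
  obtain ⟨c, hc, h | ⟨k, l, hik, hkl, hlj, h⟩⟩ := gen_mul_gen hq hij
  · exact ⟨c, hc, 0, by rw [h, add_zero], fun h0 => (h0 rfl).elim⟩
  · refine ⟨c, hc, _, h, fun h0 => ⟨_, ?_, lexLT_single_add_single hik hkl hlj⟩⟩
    refine isLM_of_sub_mem_below (c := q - q⁻¹) ?_ ?_
    · rintro h1
      rw [h1, zero_smul] at h0
      exact h0 rfl
    · rw [gen_mul_gen_eq_monomial hkl, sub_self]
      exact zero_mem _

end Algebra

end QuantumMatrix

theorem theorem2p3 (K : Type*) [Field K] [CharZero K] (n : ℕ) (q : K) (hq : q ≠ 0) :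
    SolvablePoly.IsSolvableWith K (QuantumMatrix.gen n q) (QuantumMatrix.monLT n) ∧
    SolvablePoly.IsSolvablePolynomialAlgebra K (QuantumMatrix.Mq n q) :=
  ⟨QuantumMatrix.isSolvableWith_gen hq, _, _, _, QuantumMatrix.isSolvableWith_gen hq⟩
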